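/- Let $V$ be a separable right quaternionic Hilbert space: a right $\mathbb{H}$-module with an $\mathbb{H}$-valued inner product $\langle\cdot\mid\cdot\rangle$ that is additive, satisfies $\overline{\langle\phi\mid\psi\rangle}=\langle\psi\mid\phi\rangle$ and $\langle\phi\mid\psi q\rangle=\langle\phi\mid\psi\rangle q$, and is such that $\|\phi\|^2=\langle\phi\mid\phi\rangle$ defines a complete separable norm. Let $\mathcal{B}(V)$ be the set of bounded right $\mathbb{H}$-linear operators on $V$ and $\mathcal{B}_0(V)\subseteq\mathcal{B}(V)$ the compact ones. For $A\in\mathcal{B}(V)$ and $q\in\mathbb{H}$ put $R_q(A)=A^2-2\operatorname{Re}(q)A+|q|^2 I$, let the S-spectrum of $A$ be $$\sigma_S(A)=\{q\in\mathbb{H} : R_q(A)\text{ has no inverse in }\mathcal{B}(V)\},$$ and let the Weyl S-spectrum of $A$ be $$\sigma_w^S(A)=\bigcap_{K\in\mathcal{B}_0(V)}\sigma_S(A+K).$$ Call $T\in\mathcal{B}(V)$ a Weyl operator if $\ker T$ and $V/\operatorname{ran}T$ are finite dimensional over $\mathbb{H}$ and $\dim\ker T=\dim(V/\operatorname{ran}T)$,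 that is, if $T$ is Fredholm of index zero. Then for every $A\in\mathcal{B}(V)$, $$\sigma_w^S(A)=\{q\in\mathbb{H} : R_q(A)\text{ is not a Weyl operator}\}.$$ -/

import Mathlib

open scoped Quaternion

namespace QuatWeyl

/-- A right quaternionic inner product, inducing the norm of `V`.  The right multiplication `φ q`
of a vector by a quaternion is `MulOpposite.op q • φ`. -/
class RightQuatInner (V : Type*) [NormedAddCommGroup V] [Module ℍᵐᵒᵖ V] extends Inner ℍ V where
  star_inner : ∀ φ ψ : V, star (inner φ ψ) = inner ψ φ
  inner_self : ∀ φ : V, inner φ φ = ((‖φ‖ ^ 2 : ℝ) : ℍ)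
  inner_add_right : ∀ φ ψ ω : V, inner φ (ψ + ω) = inner φ ψ + inner φ ω
  inner_smul_right : ∀ (φ ψ : V) (q : ℍ), inner φ (MulOpposite.op q • ψ) = inner φ ψ * q

/-- The other law of a right quaternionic inner product, `⟨φ q | ψ⟩ = q̄ ⟨φ | ψ⟩`. -/
theorem RightQuatInner.inner_smul_left {V : Type*} [NormedAddCommGroup V] [Module ℍᵐᵒᵖ V]
    [RightQuatInner V] (φ ψ : V) (q : ℍ) :
    inner ℍ (MulOpposite.op q • φ) ψ = star q * inner ℍ φ ψ := by
  rw [← RightQuatInner.star_inner, RightQuatInner.inner_smul_right, star_mul,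
    RightQuatInner.star_inner]

section Operators

/- The real structure of `V` is the one coming from the quaternionic structure
(`IsScalarTower ℝ ℍᵐᵒᵖ V`); `V →L[ℍᵐᵒᵖ] V` is the ring of bounded right linear operators. -/
variable {V : Type*} [NormedAddCommGroup V] [NormedSpace ℝ V] [Module ℍᵐᵒᵖ V]
  [IsScalarTower ℝ ℍᵐᵒᵖ V]

/-- The pseudo-resolvent `R_q(A) = A² - 2 Re(q) A + |q|² I`. -/
noncomputable def pseudoResolvent (q : ℍ) (A : V →L[ℍᵐᵒᵖ] V) : V →L[ℍᵐᵒᵖ] V :=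
  A ^ 2 - (2 * q.re) • A + (‖q‖ ^ 2) • (1 : V →L[ℍᵐᵒᵖ] V)

/-- The S-spectrum of a bounded operator: those `q` for which `R_q(A)` has no bounded right linear
inverse. -/
def sSpectrum (A : V →L[ℍᵐᵒᵖ] V) : Set ℍ :=
  {q | ¬ IsUnit (pseudoResolvent q A)}

/-- The Weyl S-spectrum: the intersection of the S-spectra of all compact perturbations. -/
def weylSSpectrum (A : V →L[ℍᵐᵒᵖ] V) : Set ℍ :=
  ⋂ K ∈ {K : V →L[ℍᵐᵒᵖ] V | IsCompactOperator K}, sSpectrum (A + K)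

end Operators

section Fredholm

variable {V : Type*} [NormedAddCommGroup V] [Module ℍᵐᵒᵖ V]

/-- Fredholm operators: finite-dimensional kernel and cokernel, over the quaternions. -/
def IsFredholm (A : V →L[ℍᵐᵒᵖ] V) : Prop :=
  FiniteDimensional ℍᵐᵒᵖ A.ker ∧ FiniteDimensional ℍᵐᵒᵖ (V ⧸ A.range)

/-- The index `dim ker A - dim coker A` (meaningful for Fredholm `A`), with quaternionic
dimensions. -/
noncomputable def index (A : V →L[ℍᵐᵒᵖ] V) : ℤ :=
  (Module.finrank ℍᵐᵒᵖ A.ker : ℤ) - (Module.finrank ℍᵐᵒᵖ (V ⧸ A.range) : ℤ)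

/-- Weyl operators: Fredholm operators of index zero. -/
def IsWeyl (A : V →L[ℍᵐᵒᵖ] V) : Prop :=
  IsFredholm A ∧ index A = 0

end Fredholm

end QuatWeyl

/-! If `R_q(A + K)` is invertible with `K` compact, then `R_q(A)` differs from it by a compact
operator, hence is Fredholm of index zero. For the converse the perturbation must be made in `A`,
not in `R_q(A)`. The quadratic factors as `R_q(A) = T_{q̄} T_q`, where `T_q v = A v - v q` is only
real linear; real dimensions are four times quaternionic ones, so index zero can be tested over `ℝ`.
Right multiplication by some `w ≠ 0` with `w q = q̄ w` conjugates `T_q` and `T_{q̄}`, so they have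
equal index, and `2 ind T_q = ind R_q(A) = 0`. While `T_q` is not injective, choose `v` in its
kernel and `y` outside its range: a small real multiple of the right linear operator `x ↦ y⟨v|x⟩`,
added to `A`, shrinks the real kernel. Finitely many such steps make `T_q`, hence `T_{q̄}` and
`R_q(A + K)`, bijective. -/

open Module

/-! ### Algebraic index theory -/

section LinearAlgebra

variable {k M N : Type*} [Field k] [AddCommGroup M] [Module k M] [AddCommGroup N] [Module k N]

/-- A linear map with finite-dimensional kernel and cokernel. -/
def LinearMap.HasIndex (f : M →ₗ[k] N) : Prop :=
  FiniteDimensional k f.ker ∧ FiniteDimensional k (N ⧸ f.range)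

namespace LinearMap

theorem HasIndex.of_equiv (e : M ≃ₗ[k] N) : (e : M →ₗ[k] N).HasIndex := by
  constructor
  · rw [LinearEquiv.ker]; infer_instance
  · rw [LinearEquiv.range]; infer_instance

theorem HasIndex.comp {P : Type*} [AddCommGroup P] [Module k P] {g : N →ₗ[k] P} {f : M →ₗ[k] N}
    (hg : g.HasIndex) (hf : f.HasIndex) : (g ∘ₗ f).HasIndex := by
  obtain ⟨_, _⟩ := hg
  obtain ⟨_, _⟩ := hf
  constructor
  · rw [ker_comp]; infer_instance
  · rw [range_comp]; infer_instance

theorem finiteDimensional_coker_of_comp {P : Type*} [AddCommGroup P] [Module k P] (g : N →ₗ[k] P)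
    (f : M →ₗ[k] N) [FiniteDimensional k (P ⧸ (g ∘ₗ f).range)] :
    FiniteDimensional k (P ⧸ g.range) :=
  Module.Finite.of_surjective _ (Submodule.factor_surjective (range_comp_le_range f g))

/-- `S` and `T` agree on `ker (T - S)`, which has finite codimension. Composing each with its
inclusion gives the same map, and additivity of the index cancels the inclusion. -/
theorem HasIndex.of_sub {S T : M →ₗ[k] N} (hS : S.HasIndex)
    [FiniteDimensional k (T - S).range] : T.HasIndex ∧ T.index = S.index := by
  have hι : (T - S).ker.subtype.HasIndex := by
    constructor
    · rw [Submodule.ker_subtype]; infer_instance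
    · rw [Submodule.range_subtype]
      exact (T - S).quotKerEquivRange.symm.finiteDimensional
  have hcomp : T ∘ₗ (T - S).ker.subtype = S ∘ₗ (T - S).ker.subtype := by
    ext ⟨x, hx⟩
    simpa [sub_eq_zero] using hx
  have hSι := hS.comp hι
  have hT : T.HasIndex := by
    constructor
    · rw [← Submodule.fg_iff_finiteDimensional]
      refine Submodule.fg_of_fg_map_of_fg_inf_ker (T - S) ?_ ?_
      · rw [Submodule.fg_iff_finiteDimensional]
        exact Submodule.finiteDimensional_of_le (map_le_range (f := T - S))
      · rw [Submodule.fg_iff_finiteDimensional]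
        have := hS.1
        refine Submodule.finiteDimensional_of_le (S₂ := S.ker) fun x hx => ?_
        obtain ⟨h₁, h₂⟩ := hx
        have h₁ : T x = 0 := h₁
        have h₂ : T x - S x = 0 := h₂
        simpa [h₁] using h₂
    · have := hSι.2
      rw [← hcomp] at this
      exact finiteDimensional_coker_of_comp T (T - S).ker.subtype
  refine ⟨hT, ?_⟩
  obtain ⟨_, _⟩ := hS
  obtain ⟨_, _⟩ := hT
  obtain ⟨_, _⟩ := hι
  have h := index_comp (f := (T - S).ker.subtype) T
  rw [hcomp, index_comp] at h
  lia

theorem HasIndex.injective_iff_surjective {T : M →ₗ[k] N} (hT : T.HasIndex) (h0 : T.index = 0) :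
    Function.Injective T ↔ Function.Surjective T := by
  obtain ⟨_, _⟩ := hT
  rw [index_eq_finrank_sub] at h0
  rw [← ker_eq_bot, ← range_eq_top, ← Submodule.finrank_eq_zero,
    ← Submodule.Quotient.subsingleton_iff, ← finrank_zero_iff (R := k)]
  lia

end LinearMap

end LinearAlgebra

/-! ### Index-zero operators on a Banach space -/

section Banach

variable {E : Type*} [NormedAddCommGroup E] [NormedSpace ℝ E]

/-- `P` projects onto `ker T`, and `L` carries `ker T` isomorphically onto a complement of the
range, which has the same dimension because the index is zero. -/
theorem ContinuousLinearMap.exists_equiv_add_comp_proj [CompleteSpace E] (T : E →L[ℝ] E)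
    (hT : (T : E →ₗ[ℝ] E).HasIndex) (h0 : (T : E →ₗ[ℝ] E).index = 0) :
    ∃ (P : E →L[ℝ] E) (L : E →L[ℝ] E) (U : E ≃L[ℝ] E), (∀ x, T (P x) = 0) ∧
      (∀ x, T x = 0 → P x = x) ∧ ∀ x, U x = T x + L (P x) := by
  obtain ⟨_, _⟩ := hT
  obtain ⟨C, hC⟩ := Submodule.exists_isCompl (T : E →ₗ[ℝ] E).range
  have eC := Submodule.quotientEquivOfIsCompl _ _ hC
  have : FiniteDimensional ℝ C := eC.finiteDimensional
  rw [LinearMap.index_eq_finrank_sub, eC.finrank_eq] at h0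
  have φ : (T : E →ₗ[ℝ] E).ker ≃ₗ[ℝ] C := LinearEquiv.ofFinrankEq _ _ (by lia)
  obtain ⟨p, hp⟩ := Submodule.ClosedComplemented.of_finiteDimensional (T : E →ₗ[ℝ] E).ker
  let P : E →L[ℝ] E := (T : E →ₗ[ℝ] E).ker.subtypeL ∘L p
  let L : E →L[ℝ] E := C.subtypeL ∘L φ.toLinearMap.toContinuousLinearMap ∘L p
  have hTP : ∀ x, T (P x) = 0 := fun x => (p x).2
  have hP : ∀ x, T x = 0 → P x = x := fun x hx => congrArg Subtype.val (hp ⟨x, hx⟩)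
  have hpP : ∀ x, p (P x) = p x := fun x => hp (p x)
  have hLP : ∀ x, L (P x) = φ (p x) := fun x => by simp [L, hpP]
  have hinj : Function.Injective (T + L ∘L P) := by
    rw [injective_iff_map_eq_zero]
    intro x hx
    have hx : T x + φ (p x) = 0 := by simpa [hLP] using hx
    have h1 : (φ (p x) : E) ∈ (T : E →ₗ[ℝ] E).range :=
      ⟨-x, by simpa using (eq_neg_of_add_eq_zero_right hx).symm⟩
    have h2 : (φ (p x) : E) = 0 := (Submodule.disjoint_def.1 hC.disjoint) _ h1 (φ (p x)).2
    have h3 : p x = 0 := by simpa using h2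
    have h4 : P x = 0 := by simp [P, h3]
    rw [← hP x (by simpa [h3] using hx), h4]
  have hsurj : Function.Surjective (T + L ∘L P) := by
    intro y
    obtain ⟨⟨_, x, rfl⟩, c, hy⟩ : ∃ (a : (T : E →ₗ[ℝ] E).range) (c : C), (a : E) + c = y := by
      have : y ∈ (T : E →ₗ[ℝ] E).range ⊔ C := hC.sup_eq_top ▸ Submodule.mem_top
      obtain ⟨a, ha, c, hc, h⟩ := Submodule.mem_sup.1 this
      exact ⟨⟨a, ha⟩, ⟨c, hc⟩, h⟩
    refine ⟨x - P x + φ.symm c, ?_⟩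
    have h1 : p (x - P x + φ.symm c) = φ.symm c := by
      rw [map_add, map_sub, hpP, sub_self, zero_add, hp]
    have h2 : T (φ.symm c) = 0 := (φ.symm c).2
    simp only [add_apply, comp_apply, hLP, h1]
    simpa [hTP, h2] using hy
  refine ⟨P, L, ContinuousLinearEquiv.ofBijective (T + L ∘L P)
    (LinearMap.ker_eq_bot.2 hinj) (LinearMap.range_eq_top.2 hsurj), hTP, hP, fun x => rfl⟩

/-- A small perturbation of an operator of index zero by an operator that maps some vector of the
kernel outside of the range has a smaller kernel. -/
theorem ContinuousLinearMap.exists_finrank_ker_add_smul_lt [CompleteSpace E] (T K : E →L[ℝ] E)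
    (hT : (T : E →ₗ[ℝ] E).HasIndex) (h0 : (T : E →ₗ[ℝ] E).index = 0) {v : E} (hv : T v = 0)
    (hKv : K v ∉ (T : E →ₗ[ℝ] E).range) :
    ∃ ε : ℝ, finrank ℝ ((T + ε • K : E →L[ℝ] E) : E →ₗ[ℝ] E).ker
      < finrank ℝ (T : E →ₗ[ℝ] E).ker := by
  obtain ⟨P, L, U, hTP, hP, hU⟩ := T.exists_equiv_add_comp_proj hT h0
  have := hT.1
  let G : E →L[ℝ] E := (U.symm : E →L[ℝ] E)
  have hGU : ∀ x, G (T x + L (P x)) = x := fun x => by rw [← hU]; simp [G]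
  have hPP : ∀ x, P (P x) = P x := fun x => hP _ (hTP x)
  have hGL : ∀ x, G (L (P x)) = P x := fun x => by simpa [hTP, hPP] using hGU (P x)
  have hGT : ∀ x, G (T x) = x - P x := fun x => by
    have := hGU x
    rw [map_add, hGL] at this
    exact eq_sub_of_add_eq this
  have hrange : ∀ y, P (G y) = 0 → y ∈ (T : E →ₗ[ℝ] E).range := fun y hy => by
    refine ⟨G y, ?_⟩
    have := hU (G y)
    rw [hy, map_zero, add_zero] at this
    simpa [G] using this.symm
  -- By `hrange`, `c` detects the component of `K v` outside the range of `T`.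
  set c : E := P (G (K v)) with hc
  have hc0 : 0 < ‖c‖ := norm_pos_iff.2 fun h => hKv (hrange _ h)
  set D : ℝ := ‖G ∘L K‖
  set D' : ℝ := ‖P ∘L G ∘L K‖
  have hDx : ∀ x, ‖G (K x)‖ ≤ D * ‖x‖ := (G ∘L K).le_opNorm
  have hDx' : ∀ x, ‖P (G (K x))‖ ≤ D' * ‖x‖ := (P ∘L G ∘L K).le_opNorm
  have hD0 : 0 ≤ D := norm_nonneg _
  have hD0' : 0 ≤ D' := norm_nonneg _
  -- The first bound makes `P` injective on the perturbed kernel; the second makes the second-order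
  -- term smaller than `c`.
  obtain ⟨ε, hε, hε1, hε2⟩ : ∃ ε : ℝ, 0 < ε ∧ ε * D ≤ 1 / 2 ∧
      ε * (D' * D * (2 * ‖v‖)) ≤ ‖c‖ / 2 := by
    set B := D' * D * (2 * ‖v‖)
    have hB0 : 0 ≤ B := by positivity
    refine ⟨min (1 / 2 / (D + 1)) (‖c‖ / 2 / (B + 1)), by positivity, ?_, ?_⟩
    · calc _ ≤ 1 / 2 / (D + 1) * (D + 1) := by gcongr; exacts [min_le_left _ _, by linarith]
        _ = 1 / 2 := by field_simp
    · calc _ ≤ ‖c‖ / 2 / (B + 1) * (B + 1) := by gcongr; exacts [min_le_right _ _, by linarith]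
        _ = ‖c‖ / 2 := by field_simp
  refine ⟨ε, ?_⟩
  set X := ((T + ε • K : E →L[ℝ] E) : E →ₗ[ℝ] E).ker with hX
  have hXmem : ∀ x ∈ X, T x = -(ε • K x) := fun x hx =>
    eq_neg_of_add_eq_zero_left (by simpa [X] using hx)
  have hXP : ∀ x ∈ X, x = P x - ε • G (K x) := fun x hx => by
    have := hGT x
    rw [hXmem x hx, map_neg, map_smul] at this
    rw [sub_eq_add_neg, this]; abel
  have hXn : ∀ x ∈ X, ‖x‖ ≤ 2 * ‖P x‖ := fun x hx => by
    have h1 : ‖x‖ ≤ ‖P x‖ + ε * (D * ‖x‖) := by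
      calc ‖x‖ = ‖P x - ε • G (K x)‖ := by rw [← hXP x hx]
        _ ≤ ‖P x‖ + ‖ε • G (K x)‖ := norm_sub_le _ _
        _ ≤ _ := by
          rw [norm_smul, Real.norm_of_nonneg hε.le]
          gcongr
          exact hDx x
    have h2 : ε * D * ‖x‖ ≤ 1 / 2 * ‖x‖ := by gcongr
    linarith
  let π : X →ₗ[ℝ] (T : E →ₗ[ℝ] E).ker :=
    ((P : E →ₗ[ℝ] E).codRestrict _ fun x => hTP x) ∘ₗ X.subtype
  have hπ : ∀ x : X, (π x : E) = P x := fun x => rfl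
  have hinj : Function.Injective π := by
    rw [injective_iff_map_eq_zero]
    intro x hx
    have h1 : P x = 0 := by rw [← hπ, hx]; rfl
    have h2 := hXn x x.2
    rw [h1, norm_zero, mul_zero] at h2
    exact Subtype.ext (norm_le_zero_iff.1 h2)
  have hXfin : FiniteDimensional ℝ X := Module.Finite.of_injective π hinj
  -- If the dimensions were equal, `v = P x` for some `x` in the perturbed kernel; expanding `P (G
  -- (K x)) = 0` around `v` would give `c = O(ε)`.
  refine lt_of_le_of_ne (LinearMap.finrank_le_finrank_of_injective hinj) fun heq => ?_
  have hsurj := (LinearMap.injective_iff_surjective_of_finrank_eq_finrank heq).1 hinj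
  obtain ⟨x, hx⟩ := hsurj ⟨v, hv⟩
  have hPx : P x = v := by rw [← hπ, hx]
  have hx1 : (x : E) = v - ε • G (K x) := by
    have := hXP x x.2
    rwa [hPx] at this
  have hPGK : P (G (K x)) = 0 := by
    have h1 : P (x : E) = P v - ε • P (G (K x)) := by
      conv_lhs => rw [hx1]
      simp
    rw [hPx, hP v hv] at h1
    have h2 : ε • P (G (K x)) = 0 := sub_eq_self.1 h1.symm
    exact (smul_eq_zero.1 h2).resolve_left hε.ne'
  have hc' : c = ε • P (G (K (G (K x)))) := by
    have h1 : v = x + ε • G (K x) := by rw [eq_sub_iff_add_eq] at hx1; exact hx1.symm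
    have h2 : P (G (K v)) = P (G (K x)) + ε • P (G (K (G (K x)))) := by
      conv_lhs => rw [h1]
      simp
    rw [hc, h2, hPGK, zero_add]
  have h3 : ‖c‖ ≤ ε * (D' * D * (2 * ‖v‖)) := by
    rw [hc', norm_smul, Real.norm_of_nonneg hε.le]
    have h4 := hXn x x.2
    rw [hPx] at h4
    gcongr
    calc _ ≤ D' * ‖G (K x)‖ := hDx' _
      _ ≤ D' * (D * ‖(x : E)‖) := by gcongr; exact hDx _
      _ ≤ D' * (D * (2 * ‖v‖)) := by gcongr
      _ = _ := by ring
  linarith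

end Banach

/-! ### Compact perturbations of invertible operators -/

section Hilbert

variable {E F : Type*} [NormedAddCommGroup E] [NormedSpace ℝ E] [NormedAddCommGroup F]
  [InnerProductSpace ℝ F]

/-- Compact operators into a Hilbert space are norm limits of operators of finite rank. -/
theorem IsCompactOperator.exists_finiteRank_norm_sub_le {K : E →L[ℝ] F} (hK : IsCompactOperator K)
    {ε : ℝ} (hε : 0 < ε) :
    ∃ K' : E →L[ℝ] F, FiniteDimensional ℝ (K' : E →ₗ[ℝ] F).range ∧ ‖K - K'‖ ≤ ε := by
  obtain ⟨t, ht, hcov⟩ := Metric.totallyBounded_iff.1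
    (hK.isCompact_closure_image_closedBall (f := (K : E →ₗ[ℝ] F)) 1).totallyBounded ε hε
  have := ht.to_subtype
  let S := Submodule.span ℝ t
  have : FiniteDimensional ℝ S := FiniteDimensional.span_of_finite ℝ ht
  refine ⟨S.starProjection ∘L K, ?_, ?_⟩
  · refine Submodule.finiteDimensional_of_le (S₂ := S) ?_
    rintro _ ⟨x, rfl⟩
    exact S.starProjection_apply_mem _
  · refine ContinuousLinearMap.opNorm_le_of_unit_norm hε.le fun x hx => ?_
    have hKx : K x ∈ closure ((K : E →ₗ[ℝ] F) '' Metric.closedBall 0 1) :=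
      subset_closure ⟨x, by simp [hx], rfl⟩
    obtain ⟨y, hy, hxy⟩ := Set.mem_iUnion₂.1 (hcov hKx)
    have h1 : ‖K x - S.starProjection (K x)‖ ≤ ‖K x - y‖ := by
      rw [S.starProjection_minimal]
      exact ciInf_le ⟨0, by rintro _ ⟨_, rfl⟩; positivity⟩ (⟨y, Submodule.subset_span hy⟩ : S)
    rw [Metric.mem_ball, dist_eq_norm] at hxy
    exact h1.trans hxy.le

/-- With `K'` of finite rank close to `K`, the operator `B + (K - K')` is still invertible, and `B +
K` differs from it by `K'`. -/
theorem ContinuousLinearEquiv.hasIndex_add_of_isCompactOperator [CompleteSpace F] (B : F ≃L[ℝ] F)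
    {K : F →L[ℝ] F} (hK : IsCompactOperator K) :
    (((B : F →L[ℝ] F) + K : F →L[ℝ] F) : F →ₗ[ℝ] F).HasIndex ∧
      (((B : F →L[ℝ] F) + K : F →L[ℝ] F) : F →ₗ[ℝ] F).index = 0 := by
  obtain ⟨δ, hδ, hball⟩ := Metric.isOpen_iff.1 (ContinuousLinearEquiv.isOpen (𝕜 := ℝ) (E := F)
    (F := F)) _ ⟨B, rfl⟩
  obtain ⟨K', hfin, hK'⟩ := hK.exists_finiteRank_norm_sub_le (half_pos hδ)
  obtain ⟨U, hU⟩ : ((B : F →L[ℝ] F) + (K - K')) ∈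
      Set.range ((↑) : (F ≃L[ℝ] F) → F →L[ℝ] F) := by
    apply hball
    rw [Metric.mem_ball, dist_eq_norm, add_sub_cancel_left]
    linarith
  have hS := LinearMap.HasIndex.of_equiv U.toLinearEquiv
  have hsub : (((B : F →L[ℝ] F) + K : F →L[ℝ] F) : F →ₗ[ℝ] F) -
      (U.toLinearEquiv : F →ₗ[ℝ] F) = (K' : F →ₗ[ℝ] F) := by
    ext x
    have : U x = B x + (K x - K' x) := congr($hU x)
    simp [this]
  have : FiniteDimensional ℝ ((((B : F →L[ℝ] F) + K : F →L[ℝ] F) : F →ₗ[ℝ] F) -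
      (U.toLinearEquiv : F →ₗ[ℝ] F)).range := by rwa [hsub]
  obtain ⟨h1, h2⟩ := hS.of_sub (T := (((B : F →L[ℝ] F) + K : F →L[ℝ] F) : F →ₗ[ℝ] F))
  exact ⟨h1, h2.trans LinearEquiv.index_eq_zero⟩

end Hilbert

namespace QuatWeyl

open Module MulOpposite

/-! ### Passage from quaternionic to real scalars -/

section RealStructure

variable {M : Type*} [AddCommGroup M] [Module ℝ M] [Module ℍᵐᵒᵖ M] [IsScalarTower ℝ ℍᵐᵒᵖ M]

instance : Module.Finite ℝ ℍᵐᵒᵖ :=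
  Module.Finite.equiv (opLinearEquiv ℝ : ℍ ≃ₗ[ℝ] ℍᵐᵒᵖ)

theorem finrank_real_op : finrank ℝ ℍᵐᵒᵖ = 4 := by
  rw [← (opLinearEquiv ℝ : ℍ ≃ₗ[ℝ] ℍᵐᵒᵖ).finrank_eq, Quaternion.finrank_eq_four]

variable (M) in
theorem finrank_real_eq_four_mul : finrank ℝ M = 4 * finrank ℍᵐᵒᵖ M := by
  rw [← finrank_real_op, Module.finrank_mul_finrank]

variable (M) in
theorem finiteDimensional_iff_real : FiniteDimensional ℍᵐᵒᵖ M ↔ FiniteDimensional ℝ M :=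
  ⟨fun _ => Module.Finite.trans ℍᵐᵒᵖ M, fun _ => Module.Finite.of_restrictScalars_finite ℝ ℍᵐᵒᵖ M⟩

theorem coe_real_smul (r : ℝ) (v : M) : op (r : ℍ) • v = r • v := by
  have : op (r : ℍ) = r • (1 : ℍᵐᵒᵖ) := by
    rw [← op_one, ← op_smul, ← Quaternion.coe_mul_eq_smul, mul_one]
  rw [this, smul_assoc, one_smul]

end RealStructure

/-! ### Right linear operators and the pseudo-resolvent -/

section Operators

variable {V : Type*} [NormedAddCommGroup V] [NormedSpace ℝ V] [Module ℍᵐᵒᵖ V]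
  [IsScalarTower ℝ ℍᵐᵒᵖ V]

theorem isWeyl_iff_real (A : V →L[ℍᵐᵒᵖ] V) :
    IsWeyl A ↔ (A.restrictScalars ℝ : V →ₗ[ℝ] V).HasIndex ∧
      (A.restrictScalars ℝ : V →ₗ[ℝ] V).index = 0 := by
  have hk : (A.restrictScalars ℝ : V →ₗ[ℝ] V).ker = (A : V →ₗ[ℍᵐᵒᵖ] V).ker.restrictScalars ℝ := rfl
  have hr : (A.restrictScalars ℝ : V →ₗ[ℝ] V).range =
      (A : V →ₗ[ℍᵐᵒᵖ] V).range.restrictScalars ℝ := rfl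
  have ek : (A.restrictScalars ℝ : V →ₗ[ℝ] V).ker ≃ₗ[ℝ] (A : V →ₗ[ℍᵐᵒᵖ] V).ker :=
    LinearEquiv.refl ℝ (A : V →ₗ[ℍᵐᵒᵖ] V).ker
  have er : (V ⧸ (A.restrictScalars ℝ : V →ₗ[ℝ] V).range) ≃ₗ[ℝ] (V ⧸ (A : V →ₗ[ℍᵐᵒᵖ] V).range) :=
    Submodule.Quotient.restrictScalarsEquiv ℝ (A : V →ₗ[ℍᵐᵒᵖ] V).range
  rw [IsWeyl, IsFredholm, index, LinearMap.HasIndex, LinearMap.index_eq_finrank_sub,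
    ek.finrank_eq, er.finrank_eq, finrank_real_eq_four_mul, finrank_real_eq_four_mul,
    finiteDimensional_iff_real, finiteDimensional_iff_real]
  refine and_congr (and_congr ?_ ?_) (by push_cast; lia)
  · exact ⟨fun _ => ek.symm.finiteDimensional, fun _ => ek.finiteDimensional⟩
  · exact ⟨fun _ => er.symm.finiteDimensional, fun _ => er.finiteDimensional⟩

/-- The open mapping theorem for the underlying real operator gives continuity of the quaternionic
inverse. -/
theorem isUnit_of_bijective [CompleteSpace V] {A : V →L[ℍᵐᵒᵖ] V} (hA : Function.Bijective A) :
    IsUnit A := by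
  let e := LinearEquiv.ofBijective (A : V →ₗ[ℍᵐᵒᵖ] V) hA
  let e' := ContinuousLinearEquiv.ofBijective (A.restrictScalars ℝ)
    (LinearMap.ker_eq_bot.2 hA.1) (LinearMap.range_eq_top.2 hA.2)
  have hcont : Continuous e.symm := by
    have : (e.symm : V → V) = e'.symm := by
      ext x
      apply hA.1
      exact (e.apply_symm_apply x).trans (e'.apply_symm_apply x).symm
    rw [this]
    exact e'.symm.continuous
  let B : V →L[ℍᵐᵒᵖ] V := ⟨e.symm, hcont⟩
  refine ⟨⟨A, B, ?_, ?_⟩, rfl⟩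
  · ext x
    exact e.apply_symm_apply x
  · ext x
    exact e.symm_apply_apply x

theorem isCompactOperator_of_finiteDimensional_range {K : V →L[ℍᵐᵒᵖ] V}
    (hK : FiniteDimensional ℝ (K.restrictScalars ℝ : V →ₗ[ℝ] V).range) : IsCompactOperator K := by
  let S := (K.restrictScalars ℝ : V →ₗ[ℝ] V).range
  have : ProperSpace S := FiniteDimensional.proper_real S
  exact (isCompactOperator_of_locallyCompactSpace_dom
    ((K.restrictScalars ℝ).codRestrict S fun x => ⟨x, rfl⟩)).clm_comp S.subtypeL

theorem pseudoResolvent_star (q : ℍ) (A : V →L[ℍᵐᵒᵖ] V) :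
    pseudoResolvent (star q) A = pseudoResolvent q A := by
  simp [pseudoResolvent]

theorem finiteDimensional_range_add {K L : V →L[ℍᵐᵒᵖ] V}
    (hK : FiniteDimensional ℝ (K.restrictScalars ℝ : V →ₗ[ℝ] V).range)
    (hL : FiniteDimensional ℝ (L.restrictScalars ℝ : V →ₗ[ℝ] V).range) :
    FiniteDimensional ℝ ((K + L).restrictScalars ℝ : V →ₗ[ℝ] V).range := by
  refine Submodule.finiteDimensional_of_le (S₂ := (K.restrictScalars ℝ : V →ₗ[ℝ] V).range ⊔
    (L.restrictScalars ℝ : V →ₗ[ℝ] V).range) ?_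
  rintro _ ⟨x, rfl⟩
  exact Submodule.add_mem_sup ⟨x, rfl⟩ ⟨x, rfl⟩

theorem finiteDimensional_range_real_smul (r : ℝ) {K : V →L[ℍᵐᵒᵖ] V}
    (hK : FiniteDimensional ℝ (K.restrictScalars ℝ : V →ₗ[ℝ] V).range) :
    FiniteDimensional ℝ ((r • K).restrictScalars ℝ : V →ₗ[ℝ] V).range := by
  refine Submodule.finiteDimensional_of_le (S₂ := (K.restrictScalars ℝ : V →ₗ[ℝ] V).range) ?_
  rintro _ ⟨x, rfl⟩
  exact Submodule.smul_mem _ r ⟨x, rfl⟩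

theorem pseudoResolvent_add_sub (q : ℍ) (A K : V →L[ℍᵐᵒᵖ] V) :
    pseudoResolvent q A - pseudoResolvent q (A + K) =
      (2 * q.re) • K - (A + K) * K - K * A := by
  simp only [pseudoResolvent, pow_two, smul_add, mul_add, add_mul]
  abel

theorem isCompactOperator_pseudoResolvent_sub (q : ℍ) (A : V →L[ℍᵐᵒᵖ] V) {K : V →L[ℍᵐᵒᵖ] V}
    (hK : IsCompactOperator K) :
    IsCompactOperator (pseudoResolvent q A - pseudoResolvent q (A + K)) := by
  rw [pseudoResolvent_add_sub]
  exact ((hK.smul (2 * q.re)).sub (hK.clm_comp (A + K))).sub (hK.comp_clm A)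

end Operators

/-- A purely imaginary `w` orthogonal to `Im q` anticommutes with `Im q`. -/
theorem exists_ne_zero_mul_eq_star_mul (q : ℍ) : ∃ w : ℍ, w ≠ 0 ∧ w * q = star q * w := by
  have key (w : ℍ) (h0 : w.re = 0)
      (h1 : w.imI * q.imI + w.imJ * q.imJ + w.imK * q.imK = 0) : w * q = star q * w := by
    apply Quaternion.ext <;> simp [h0] <;> linarith
  by_cases h : q.imI = 0 ∧ q.imJ = 0
  · refine ⟨⟨0, 1, 0, 0⟩, fun h' => one_ne_zero (congrArg (fun a : ℍ => a.imI) h'),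
      key _ rfl ?_⟩
    rw [h.1, h.2]
    ring
  · refine ⟨⟨0, -q.imJ, q.imI, 0⟩, fun h' => h ⟨congrArg (fun a : ℍ => a.imJ) h',
      neg_eq_zero.1 (congrArg (fun a : ℍ => a.imI) h')⟩, key _ rfl ?_⟩
    ring

/-! ### Factorization of the pseudo-resolvent and finite-rank correction -/

section RightQuatInner

variable {V : Type*} [NormedAddCommGroup V] [NormedSpace ℝ V] [Module ℍᵐᵒᵖ V]
  [IsScalarTower ℝ ℍᵐᵒᵖ V] [RightQuatInner V]

variable (V) in
/-- The real inner product space underlying a right quaternionic inner product space. -/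
@[reducible] def realInnerProductSpace : InnerProductSpace ℝ V where
  toNormedSpace := inferInstance
  inner x y := (inner ℍ x y : ℍ).re
  norm_sq_eq_re_inner x := by
    rw [RightQuatInner.inner_self, Quaternion.re_coe]
    rfl
  conj_inner_symm x y := by
    rw [← RightQuatInner.star_inner x y]
    simp
  add_left x y z := by
    rw [← RightQuatInner.star_inner z, ← RightQuatInner.star_inner z x,
      ← RightQuatInner.star_inner z y, RightQuatInner.inner_add_right]
    simp
  smul_left x y r := by
    rw [← coe_real_smul, RightQuatInner.inner_smul_left]
    simp

omit [NormedSpace ℝ V] [IsScalarTower ℝ ℍᵐᵒᵖ V] in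
theorem norm_op_smul (q : ℍ) (v : V) : ‖op q • v‖ = ‖q‖ * ‖v‖ := by
  have h : ((‖op q • v‖ ^ 2 : ℝ) : ℍ) = (((‖q‖ * ‖v‖) ^ 2 : ℝ) : ℍ) := by
    rw [← RightQuatInner.inner_self, RightQuatInner.inner_smul_left,
      RightQuatInner.inner_smul_right, RightQuatInner.inner_self, Quaternion.coe_commutes,
      ← mul_assoc, Quaternion.star_mul_self, Quaternion.normSq_eq_norm_mul_self]
    rw [← Quaternion.coe_mul, mul_pow, pow_two ‖q‖]
  exact (pow_left_inj₀ (norm_nonneg _) (by positivity) two_ne_zero).1 (Quaternion.coe_injective h)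

/-- Real Cauchy–Schwarz applied to `v h` and `x`, with `h = ⟨v|x⟩`, since `Re ⟨v h|x⟩ = ‖h‖²`. -/
theorem norm_quatInner_le (v x : V) : ‖(inner ℍ v x : ℍ)‖ ≤ ‖v‖ * ‖x‖ := by
  let _ := realInnerProductSpace V
  set h : ℍ := inner ℍ v x with hh
  have h1 : (inner ℍ (op h • v) x : ℍ).re = ‖h‖ ^ 2 := by
    rw [RightQuatInner.inner_smul_left, ← hh, Quaternion.star_mul_self, Quaternion.re_coe,
      Quaternion.normSq_eq_norm_mul_self, pow_two]
  have h2 : (inner ℍ (op h • v) x : ℍ).re ≤ ‖op h • v‖ * ‖x‖ := real_inner_le_norm (op h • v) x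
  rw [h1, norm_op_smul] at h2
  rcases (norm_nonneg h).eq_or_lt with h0 | h0
  · rw [← h0]; positivity
  · nlinarith

/-- The right linear operator `x ↦ y ⟨v | x⟩`. -/
noncomputable def rankOne (v y : V) : V →L[ℍᵐᵒᵖ] V where
  toFun x := op (inner ℍ v x : ℍ) • y
  map_add' a b := by rw [RightQuatInner.inner_add_right, op_add, add_smul]
  map_smul' q a := by
    obtain ⟨q, rfl⟩ := op_surjective q
    rw [RightQuatInner.inner_smul_right, op_mul, mul_smul, RingHom.id_apply]
  cont := by
    let f : V →+ V := AddMonoidHom.mk' (fun x => op (inner ℍ v x : ℍ) • y) fun a b => by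
      rw [RightQuatInner.inner_add_right, op_add, add_smul]
    refine AddMonoidHomClass.continuous_of_bound f (‖v‖ * ‖y‖) fun x => ?_
    calc ‖op (inner ℍ v x : ℍ) • y‖ = ‖(inner ℍ v x : ℍ)‖ * ‖y‖ := norm_op_smul _ _
      _ ≤ ‖v‖ * ‖x‖ * ‖y‖ := by gcongr; exact norm_quatInner_le v x
      _ = ‖v‖ * ‖y‖ * ‖x‖ := by ring

theorem rankOne_apply (v y x : V) : rankOne v y x = op (inner ℍ v x : ℍ) • y := rfl

theorem rankOne_self (v y : V) : rankOne v y v = (‖v‖ ^ 2) • y := by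
  rw [rankOne_apply, RightQuatInner.inner_self, coe_real_smul]

theorem finiteDimensional_range_rankOne (v y : V) :
    FiniteDimensional ℝ ((rankOne v y).restrictScalars ℝ : V →ₗ[ℝ] V).range := by
  refine Submodule.finiteDimensional_of_le
    (S₂ := ((LinearMap.toSpanSingleton ℍᵐᵒᵖ V y).restrictScalars ℝ).range) ?_
  rintro _ ⟨x, rfl⟩
  exact ⟨op (inner ℍ v x : ℍ), rfl⟩

/-- Right multiplication by a quaternion, as a real linear operator. -/
noncomputable def rightMul (q : ℍ) : V →L[ℝ] V :=
  LinearMap.mkContinuous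
    { toFun := fun v => op q • v
      map_add' := smul_add _
      map_smul' := fun _ _ => smul_comm _ _ _ } ‖q‖ fun v => (norm_op_smul q v).le

theorem rightMul_bijective {q : ℍ} (hq : q ≠ 0) : Function.Bijective (rightMul q : V →L[ℝ] V) :=
  MulAction.bijective₀ ((op_ne_zero_iff q).2 hq)

/-- The real linear operator `v ↦ A v - v q`. -/
noncomputable def subRightMul (q : ℍ) (A : V →L[ℍᵐᵒᵖ] V) : V →L[ℝ] V :=
  A.restrictScalars ℝ - rightMul q

theorem subRightMul_apply (q : ℍ) (A : V →L[ℍᵐᵒᵖ] V) (v : V) :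
    subRightMul q A v = A v - op q • v := rfl

theorem pseudoResolvent_apply (q : ℍ) (A : V →L[ℍᵐᵒᵖ] V) (v : V) :
    pseudoResolvent q A v = subRightMul (star q) A (subRightMul q A v) := by
  have h1 : op (star q) • op q • v = (‖q‖ ^ 2) • v := by
    rw [smul_smul, ← op_mul, Quaternion.self_mul_star, Quaternion.normSq_eq_norm_mul_self,
      coe_real_smul, pow_two]
  have h2 : op q • A v + op (star q) • A v = (2 * q.re) • A v := by
    rw [← add_smul, ← op_add, Quaternion.self_add_star, ← coe_real_smul]
    push_cast
    rfl
  simp only [subRightMul_apply, map_sub, map_smul, h1]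
  have h3 : pseudoResolvent q A v = A (A v) - (2 * q.re) • A v + (‖q‖ ^ 2) • v := rfl
  rw [h3, ← h2]
  abel

theorem subRightMul_op_smul {q w : ℍ} (hw : w * q = star q * w) (A : V →L[ℍᵐᵒᵖ] V) (v : V) :
    subRightMul q A (op w • v) = op w • subRightMul (star q) A v := by
  rw [subRightMul_apply, subRightMul_apply, map_smul, smul_sub, smul_smul, smul_smul, ← op_mul,
    ← op_mul, hw]

theorem pseudoResolvent_bijective {q : ℍ} {A : V →L[ℍᵐᵒᵖ] V}
    (h : Function.Bijective (subRightMul q A)) : Function.Bijective (pseudoResolvent q A) := by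
  obtain ⟨w, hw0, hw⟩ := exists_ne_zero_mul_eq_star_mul q
  have hb := rightMul_bijective (V := V) hw0
  have h' : Function.Bijective (subRightMul (star q) A) := by
    have : rightMul w ∘ subRightMul (star q) A = subRightMul q A ∘ rightMul w := by
      ext v
      exact (subRightMul_op_smul hw A v).symm
    rw [← hb.of_comp_iff', this]
    exact h.comp hb
  have : ⇑(pseudoResolvent q A) = subRightMul (star q) A ∘ subRightMul q A := by
    ext v
    exact pseudoResolvent_apply q A v
  rw [this]
  exact h'.comp h

theorem hasIndex_subRightMul {q : ℍ} {A : V →L[ℍᵐᵒᵖ] V} (h : IsWeyl (pseudoResolvent q A)) :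
    (subRightMul q A : V →ₗ[ℝ] V).HasIndex ∧ (subRightMul q A : V →ₗ[ℝ] V).index = 0 := by
  rw [isWeyl_iff_real] at h
  obtain ⟨hR, hR0⟩ := h
  set T : V →ₗ[ℝ] V := (subRightMul q A).toLinearMap
  set T' : V →ₗ[ℝ] V := (subRightMul (star q) A).toLinearMap
  have hTT : ((pseudoResolvent q A).restrictScalars ℝ : V →ₗ[ℝ] V) = T' ∘ₗ T := by
    ext v
    exact pseudoResolvent_apply q A v
  have hTT' : ((pseudoResolvent q A).restrictScalars ℝ : V →ₗ[ℝ] V) = T ∘ₗ T' := by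
    ext v
    have := pseudoResolvent_apply (star q) A v
    rwa [pseudoResolvent_star, star_star] at this
  -- `ker S ≤ ker (S' S)` and `ran (S S') ≤ ran S`, so both orders of the factorization are needed.
  have aux : ∀ S S' : V →ₗ[ℝ] V, (S' ∘ₗ S).HasIndex → (S ∘ₗ S').HasIndex → S.HasIndex := by
    intro S S' h1 h2
    have := h1.1
    have := h2.2
    exact ⟨Submodule.finiteDimensional_of_le (LinearMap.ker_le_ker_comp S S'),
      LinearMap.finiteDimensional_coker_of_comp S S'⟩
  have h1 : T.HasIndex := aux T T' (hTT ▸ hR) (hTT' ▸ hR)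
  have h2 : T'.HasIndex := aux T' T (hTT' ▸ hR) (hTT ▸ hR)
  refine ⟨h1, ?_⟩
  obtain ⟨w, hw0, hw⟩ := exists_ne_zero_mul_eq_star_mul q
  let W : V ≃ₗ[ℝ] V := LinearEquiv.ofBijective (rightMul w : V →L[ℝ] V).toLinearMap (rightMul_bijective hw0)
  have hcomm : T ∘ₗ (W : V →ₗ[ℝ] V) = (W : V →ₗ[ℝ] V) ∘ₗ T' := by
    ext v
    exact subRightMul_op_smul hw A v
  obtain ⟨_, _⟩ := h1
  obtain ⟨_, _⟩ := h2
  obtain ⟨_, _⟩ := LinearMap.HasIndex.of_equiv W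
  have e1 : (T ∘ₗ (W : V →ₗ[ℝ] V)).index = T.index := by
    rw [LinearMap.index_comp, LinearEquiv.index_eq_zero, add_zero]
  have e2 : ((W : V →ₗ[ℝ] V) ∘ₗ T').index = T'.index := by
    rw [LinearMap.index_comp, LinearEquiv.index_eq_zero, zero_add]
  rw [hTT, LinearMap.index_comp, ← e2, ← hcomm, e1] at hR0
  lia

/-- If `v ↦ A v - v q` has index zero, it becomes bijective after a perturbation of `A` by a right
linear operator of finite rank. -/
theorem exists_finiteRank_bijective [CompleteSpace V] {q : ℍ} (A : V →L[ℍᵐᵒᵖ] V)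
    (h : (subRightMul q A : V →ₗ[ℝ] V).HasIndex) (h0 : (subRightMul q A : V →ₗ[ℝ] V).index = 0) :
    ∃ K : V →L[ℍᵐᵒᵖ] V, FiniteDimensional ℝ (K.restrictScalars ℝ : V →ₗ[ℝ] V).range ∧
      Function.Bijective (subRightMul q (A + K)) := by
  -- Strong induction, since the perturbation lowers the kernel dimension by an uncontrolled amount.
  induction hn : finrank ℝ (subRightMul q A : V →ₗ[ℝ] V).ker using Nat.strong_induction_on
    generalizing A with
  | _ n ih =>
  by_cases hinj : Function.Injective (subRightMul q A)
  · refine ⟨0, ?_, ?_⟩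
    · have : ((0 : V →L[ℍᵐᵒᵖ] V).restrictScalars ℝ : V →ₗ[ℝ] V) = 0 := rfl
      rw [this, LinearMap.range_zero]
      infer_instance
    · rw [add_zero]
      exact ⟨hinj, (h.injective_iff_surjective h0).1 hinj⟩
  have hsurj : ¬ Function.Surjective (subRightMul q A) :=
    fun hs => hinj ((h.injective_iff_surjective h0).2 hs)
  rw [injective_iff_map_eq_zero] at hinj
  push Not at hinj
  obtain ⟨v, hv, hv0⟩ := hinj
  rw [Function.Surjective] at hsurj
  push Not at hsurj
  obtain ⟨y, hy⟩ := hsurj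
  have hKv : ((rankOne v y).restrictScalars ℝ) v ∉ (subRightMul q A : V →ₗ[ℝ] V).range := by
    intro hmem
    have h1 : (‖v‖ ^ 2) • y ∈ (subRightMul q A : V →ₗ[ℝ] V).range := rankOne_self v y ▸ hmem
    rw [Submodule.smul_mem_iff _ (by positivity)] at h1
    obtain ⟨x, hx⟩ := h1
    exact hy x hx
  obtain ⟨ε, hε⟩ := (subRightMul q A).exists_finrank_ker_add_smul_lt _ h h0 hv hKv
  have hK := finiteDimensional_range_real_smul ε (finiteDimensional_range_rankOne v y)
  have hadd : subRightMul q A + ε • (rankOne v y).restrictScalars ℝ =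
      subRightMul q (A + ε • rankOne v y) := by
    ext x
    change A x - op q • x + ε • rankOne v y x = A x + ε • rankOne v y x - op q • x
    abel
  rw [hadd] at hε
  have hsub : (subRightMul q (A + ε • rankOne v y) : V →ₗ[ℝ] V) - subRightMul q A =
      ((ε • rankOne v y).restrictScalars ℝ : V →ₗ[ℝ] V) := by
    ext x
    change A x + ε • rankOne v y x - op q • x - (A x - op q • x) = ε • rankOne v y x
    abel
  have : FiniteDimensional ℝ
      ((subRightMul q (A + ε • rankOne v y) : V →ₗ[ℝ] V) - subRightMul q A).range := by rwa [hsub]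
  obtain ⟨h', h0'⟩ := h.of_sub (T := (subRightMul q (A + ε • rankOne v y) : V →ₗ[ℝ] V))
  obtain ⟨L, hL, hbij⟩ := ih _ (hn ▸ hε) _ h' (h0'.trans h0) rfl
  exact ⟨ε • rankOne v y + L, finiteDimensional_range_add hK hL, by rwa [← add_assoc]⟩

theorem isWeyl_pseudoResolvent_of_isUnit [CompleteSpace V] {q : ℍ} {A K : V →L[ℍᵐᵒᵖ] V}
    (hK : IsCompactOperator K) (h : IsUnit (pseudoResolvent q (A + K))) :
    IsWeyl (pseudoResolvent q A) := by
  let _ := realInnerProductSpace V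
  obtain ⟨u, hu⟩ := h
  have hl : ∀ x, u.inv (u.val x) = x := fun x => congr($(u.inv_val) x)
  have hr : ∀ x, u.val (u.inv x) = x := fun x => congr($(u.val_inv) x)
  let B : V ≃L[ℝ] V := ContinuousLinearEquiv.equivOfInverse (u.val.restrictScalars ℝ)
    (u.inv.restrictScalars ℝ) hl hr
  have hC := isCompactOperator_pseudoResolvent_sub q A hK
  have := B.hasIndex_add_of_isCompactOperator
    (K := (pseudoResolvent q A - pseudoResolvent q (A + K)).restrictScalars ℝ) hC
  have hsum : (B : V →L[ℝ] V) +
      (pseudoResolvent q A - pseudoResolvent q (A + K)).restrictScalars ℝ =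
      (pseudoResolvent q A).restrictScalars ℝ := by
    rw [← hu]
    ext x
    change u.val x + (pseudoResolvent q A x - u.val x) = pseudoResolvent q A x
    abel
  rw [hsum] at this
  exact (isWeyl_iff_real _).2 this

end RightQuatInner

end QuatWeyl

theorem proposition6p7 {V : Type*} [NormedAddCommGroup V] [NormedSpace ℝ V] [Module ℍᵐᵒᵖ V]
    [IsScalarTower ℝ ℍᵐᵒᵖ V] [QuatWeyl.RightQuatInner V] [CompleteSpace V]
    [TopologicalSpace.SeparableSpace V] (A : V →L[ℍᵐᵒᵖ] V) :
    QuatWeyl.weylSSpectrum A = {q : ℍ | ¬ QuatWeyl.IsWeyl (QuatWeyl.pseudoResolvent q A)} := by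
  ext q
  simp only [QuatWeyl.weylSSpectrum, QuatWeyl.sSpectrum, Set.mem_iInter, Set.mem_ofPred_eq]
  refine ⟨fun h hW => ?_, fun h K hK hu => h (QuatWeyl.isWeyl_pseudoResolvent_of_isUnit hK hu)⟩
  obtain ⟨hT, hT0⟩ := QuatWeyl.hasIndex_subRightMul hW
  obtain ⟨K, hK, hbij⟩ := QuatWeyl.exists_finiteRank_bijective A hT hT0
  exact h K (QuatWeyl.isCompactOperator_of_finiteDimensional_range hK)
    (QuatWeyl.isUnit_of_bijective (QuatWeyl.pseudoResolvent_bijective hbij))
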